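/- Let $m\ge 1$ and $(\eta_1,\dots,\eta_m)\in[1/2,1]^m$. Then there exists an SV model with Gamma-type log-volatility $(X_t,\sigma_t)_{t\in\mathbb Z}$ such that, for every $1\le h\le m$, both $(\sigma_0,\sigma_h)$ and $(X_0,X_h)$ have coefficient of tail dependence equal to $\eta_h$. Here $(X_t,\sigma_t)_{t\in\mathbb Z}$, defined on some probability space, is called an SV model with Gamma-type log-volatility if almost surely, for all $t\in\mathbb Z$, $$X_t=\sigma_t\epsilon_t,\qquad \sigma_t>0,\qquad \log\sigma_t=\sum_{i=0}^\infty\alpha_i\xi_{t-i},$$ where - $(\epsilon_t)_{t\in\mathbb Z}$ are i.i.d. real random variables with $P(\epsilon_0>0)>0$ and $E(|\epsilon_0|^{1+\delta})<\infty$ for some $\delta>0$; - $\alpha_i\in[0,1]$ for all $i\ge 0$, $\max_{i\ge 0}\alpha_i=1$, and $\alpha_i=O(i^{-\theta})$ as $i\to\infty$ for some $\theta>1$; - $(\xi_t)_{t\in\mathbb Z}$ are i.i.d. real random variables, the sequence $(\xi_t)$ being independent of the sequence $(\epsilon_t)$, with $E(\xi_0^2)<\infty$ and $P(\xi_0>z)\sim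 Kz^{\beta}e^{-z}$ as $z\to\infty$ for some real $\beta\ne-1$ and some $K>0$. A random vector $(Y_0,Y_1)$ whose components have the same distribution function $F$, with quantile function $F^{\leftarrow}(p)=\inf\{y: F(y)\ge p\}$, has coefficient of tail dependence $\eta>0$ if the function $x\mapsto P\big(Y_0>F^{\leftarrow}(1-1/x),\,Y_1>F^{\leftarrow}(1-1/x)\big)$ is regularly varying at infinity with index $-1/\eta$. A function $f$ that is positive and measurable on some half-line $[a,\infty)$ is regularly varying at infinity with index $\rho$ if $f(sx)/f(x)\to s^{\rho}$ as $x\to\infty$ for every $s>0$. -/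

import Mathlib

open MeasureTheory ProbabilityTheory Filter Topology Asymptotics

noncomputable section

/-- The (left-continuous) quantile function of a distribution `ν` on the real line,
`F^←(p) = inf {y | F(y) ≥ p}`, where `F` is the distribution function of `ν`. It is meaningful
for `p` in the open interval `(0, 1)`. -/
def quantileFn (ν : Measure ℝ) (p : ℝ) : ℝ :=
  sInf {y : ℝ | p ≤ cdf ν y}

/-- `f` is regularly varying (at infinity) with index `ρ`: on some half-line `[a, ∞)` it is
positive and measurable, and `f (s x) / f x → s ^ ρ` as `x → ∞` for all `s > 0`. -/
def IsRegularlyVarying (f : ℝ → ℝ) (ρ : ℝ) : Prop :=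
  (∃ a : ℝ, Measurable ((Set.Ici a).domRestrict f) ∧ ∀ x ∈ Set.Ici a, 0 < f x) ∧
    ∀ s : ℝ, 0 < s → Tendsto (fun x => f (s * x) / f x) atTop (𝓝 (s ^ ρ))

/-- The random vector `(Y₀, Y₁)` has equal marginal distributions, with common quantile function
`F^←`, and has coefficient of tail dependence `c > 0`: the function
`x ↦ P (Y₀ > F^←(1 - 1/x), Y₁ > F^←(1 - 1/x))` is regularly varying with index `-1/c`. -/
def HasTailDependenceCoeff {Ω : Type*} [MeasurableSpace Ω] (P : Measure Ω)
    (Y₀ Y₁ : Ω → ℝ) (c : ℝ) : Prop :=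
  0 < c ∧ IdentDistrib Y₀ Y₁ P P ∧
    IsRegularlyVarying
      (fun x => P.real {ω | quantileFn (P.map Y₀) (1 - 1 / x) < Y₀ ω ∧
        quantileFn (P.map Y₀) (1 - 1 / x) < Y₁ ω})
      (-1 / c)

/-- `(X t, σ t)`, `t ∈ ℤ`, is the stochastic volatility process with coefficients `α`,
log-volatility innovations `ξ` and return innovations `ε`, all satisfying the requirements of
an SV model with Gamma-type log-volatility. -/
structure IsGammaTypeSVModelWith {Ω : Type*} [MeasurableSpace Ω] (P : Measure Ω)
    (X σ : ℤ → Ω → ℝ) (α : ℕ → ℝ) (ξ ε : ℤ → Ω → ℝ) : Prop where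
  measurable_X : ∀ t, Measurable (X t)
  measurable_σ : ∀ t, Measurable (σ t)
  measurable_ξ : ∀ t, Measurable (ξ t)
  measurable_ε : ∀ t, Measurable (ε t)
  /-- `X_t = σ_t ε_t` -/
  X_eq : ∀ t, ∀ᵐ ω ∂P, X t ω = σ t ω * ε t ω
  σ_pos : ∀ t, ∀ᵐ ω ∂P, 0 < σ t ω
  /-- `log σ_t = ∑_{i ≥ 0} α_i ξ_{t-i}`, the series converging almost surely -/
  log_σ : ∀ t, ∀ᵐ ω ∂P, HasSum (fun i : ℕ => α i * ξ (t - i) ω) (Real.log (σ t ω))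
  /-- the return innovations are i.i.d. -/
  iIndepFun_ε : iIndepFun ε P
  identDistrib_ε : ∀ t, IdentDistrib (ε t) (ε 0) P P
  ε_pos : 0 < P {ω | 0 < ε 0 ω}
  ε_moment : ∃ δ : ℝ, 0 < δ ∧ Integrable (fun ω => |ε 0 ω| ^ (1 + δ)) P
  /-- the coefficients -/
  α_mem : ∀ i, α i ∈ Set.Icc (0 : ℝ) 1
  α_max : IsGreatest (Set.range α) 1
  α_decay : ∃ θ : ℝ, 1 < θ ∧ α =O[atTop] fun i : ℕ => (i : ℝ) ^ (-θ)
  /-- the log-volatility innovations are i.i.d. and independent of the return innovations -/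
  iIndepFun_ξ : iIndepFun ξ P
  identDistrib_ξ : ∀ t, IdentDistrib (ξ t) (ξ 0) P P
  indep_ξ_ε : IndepFun (fun ω t => ξ t ω) (fun ω t => ε t ω) P
  ξ_moment : Integrable (fun ω => ξ 0 ω ^ 2) P
  /-- Gamma-type tail: `P (ξ_0 > z) ∼ K z ^ β e ^ (-z)` as `z → ∞` -/
  ξ_tail : ∃ β K : ℝ, β ≠ -1 ∧ 0 < K ∧
    (fun z : ℝ => P.real {ω | z < ξ 0 ω}) ~[atTop] fun z => K * z ^ β * Real.exp (-z)

/-- `(X t, σ t)`, `t ∈ ℤ`, is an SV model with Gamma-type log-volatility. -/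
def IsGammaTypeSVModel {Ω : Type*} [MeasurableSpace Ω] (P : Measure Ω)
    (X σ : ℤ → Ω → ℝ) : Prop :=
  ∃ (α : ℕ → ℝ) (ξ ε : ℤ → Ω → ℝ), IsGammaTypeSVModelWith P X σ α ξ ε

end

/-! Take `ξ` standard exponential, `ε` standard Gaussian, and finitely many nonzero `α i`, arranged
so that at each lag `1 ≤ k ≤ m` the log-volatilities at times `0` and `k` share at most one
innovation, which then enters both with the same coefficient `c k`. Put `c k = η k` if `η k > 1/2`,
and share nothing if `η k = 1/2`. If nothing is shared, the variables are independent with tails of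
index `-1`, so the joint tail has index `-2`. Otherwise the joint event is `min(A, B) * exp (c E) >
y` with `A`, `B`, `E` independent; the tail of `min(A, B)` is a product of two tails, hence `O(y ^
(-2 s))` with `2 s > 1 / c`, and the factor `exp (c E)`, of tail `y ^ (-1 / c)`, dominates.

The analytic core is `scalesWith_expMix`: multiplying by `exp (c E)` produces index `-1 / c` as soon
as the tail `H` of the other factor is negligible against the tail `expMix c H` of the product.
Negligibility comes from a power bound (`isLittleO_expMix_of_le_rpow`) or, when several coefficients
equal `1`, from `H` already having index `-1` (`isLittleO_expMix_of_scalesWith`). Then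
`isRegularlyVarying_comp_quantileFn` passes from tails in `y` to tails at quantiles, and
`eq_of_pairCoeff_ne_zero` is the combinatorial fact about shared innovations. -/

noncomputable section

/-! ### Scaling of tails under exponential mixing -/

/-- `G (s y) / G y → s ^ ρ` as `y → ∞`, for all `s > 0`. -/
def ScalesWith (G : ℝ → ℝ) (ρ : ℝ) : Prop :=
  ∀ s : ℝ, 0 < s → Tendsto (fun y => G (s * y) / G y) atTop (𝓝 (s ^ ρ))

/-- If `H` is the tail of `R` and `E` is an independent standard exponential variable, this is
the tail of `exp (c E) R`. -/
def expMix (c : ℝ) (H : ℝ → ℝ) (y : ℝ) : ℝ :=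
  ∫ x in Set.Ioi 0, Real.exp (-x) * H (y * Real.exp (-(c * x)))

theorem scalesWith_of_one_le {G : ℝ → ℝ} {ρ : ℝ}
    (h : ∀ s : ℝ, 1 ≤ s → Tendsto (fun y => G (s * y) / G y) atTop (𝓝 (s ^ ρ))) :
    ScalesWith G ρ := by
  intro s hs
  rcases le_total 1 s with h1 | h1
  · exact h s h1
  have h2 := h s⁻¹ (by rw [one_le_inv₀ hs]; exact h1)
  have h3 : Tendsto (fun y : ℝ => s * y) atTop atTop := tendsto_id.const_mul_atTop hs
  have h4 := (h2.comp h3).inv₀ (Real.rpow_pos_of_pos (inv_pos.2 hs) ρ).ne'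
  rw [Real.inv_rpow hs.le, inv_inv] at h4
  refine h4.congr fun y => ?_
  simp [hs.ne']

theorem ScalesWith.mul {F G : ℝ → ℝ} {a b : ℝ} (hF : ScalesWith F a) (hG : ScalesWith G b) :
    ScalesWith (fun y => F y * G y) (a + b) := by
  intro s hs
  rw [Real.rpow_add hs]
  refine ((hF s hs).mul (hG s hs)).congr fun y => ?_
  rw [div_mul_div_comm]

theorem integrableOn_exp_neg_mul_of_antitone {H : ℝ → ℝ} (hH : Antitone H)
    (h0 : ∀ y, 0 ≤ H y) (h1 : ∀ y, H y ≤ 1) (y c a : ℝ) :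
    IntegrableOn (fun x => Real.exp (-x) * H (y * Real.exp (-(c * x)))) (Set.Ioi a) := by
  refine Integrable.mono' (integrableOn_exp_neg_Ioi a) ?_ (ae_of_all _ fun x => ?_)
  · exact ((by fun_prop : Measurable fun x : ℝ => Real.exp (-x)).mul
      (hH.measurable.comp (by fun_prop))).aestronglyMeasurable
  · rw [Real.norm_of_nonneg (mul_nonneg (Real.exp_pos _).le (h0 _))]
    exact mul_le_of_le_one_right (Real.exp_pos _).le (h1 _)

theorem setIntegral_Ioi_comp_add (f : ℝ → ℝ) (a t : ℝ) :
    ∫ x in Set.Ioi a, f (x + t) = ∫ x in Set.Ioi (a + t), f x := by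
  have h := (measurePreserving_add_right (volume : Measure ℝ) t).setIntegral_preimage_emb
    (MeasurableEquiv.addRight t).measurableEmbedding f (Set.Ioi (a + t))
  rw [← h]
  congr 2
  ext x
  simp

/-- Lack of memory: shifting the integration variable by `t` absorbs the factor `exp (c * t)`, at
the cost of a bounded interval of integration. -/
theorem expMix_mul_exp {H : ℝ → ℝ} (hH : Antitone H)
    (h0 : ∀ y, 0 ≤ H y) (h1 : ∀ y, H y ≤ 1) (c t y : ℝ) (ht : 0 ≤ t) :
    expMix c H (Real.exp (c * t) * y) = Real.exp (-t) * (expMix c H y +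
      ∫ x in Set.Ioc (-t) 0, Real.exp (-x) * H (y * Real.exp (-(c * x)))) := by
  have hi := integrableOn_exp_neg_mul_of_antitone hH h0 h1 y c (-t)
  have hu : Set.Ioi (-t) = Set.Ioi 0 ∪ Set.Ioc (-t) 0 := by
    rw [Set.union_comm, Set.Ioc_union_Ioi_eq_Ioi (by linarith)]
  have h2 := setIntegral_Ioi_comp_add
    (fun x => Real.exp (-t) * (Real.exp (-x) * H (y * Real.exp (-(c * x))))) 0 (-t)
  have h3 : expMix c H (Real.exp (c * t) * y) =
      ∫ x in Set.Ioi (-t), Real.exp (-t) * (Real.exp (-x) * H (y * Real.exp (-(c * x)))) := by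
    rw [zero_add] at h2
    rw [← h2, expMix]
    congr 1
    ext x
    rw [← mul_assoc, ← Real.exp_add, mul_comm (Real.exp (c * t)) y, mul_assoc, ← Real.exp_add]
    congr 2
    · ring
    · congr 2; ring
  rw [h3, integral_const_mul, hu, setIntegral_union ?_ measurableSet_Ioc (hi.mono_set ?_)
    (hi.mono_set ?_), expMix]
  · rw [Set.disjoint_left]; intro x hx hx'; exact absurd hx (not_lt.2 hx'.2)
  · rw [hu]; exact Set.subset_union_left
  · rw [hu]; exact Set.subset_union_right

/-- With `s = exp (c * t)`, the shift identity gives the factor `exp (-t) = s ^ (-1 / c)` up to an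
integral over `(-t, 0]`. There the argument of `H` is at least `y`, so this error is at most a
constant times `H y`, negligible by `ho`. -/
theorem scalesWith_expMix {H : ℝ → ℝ} (hH : Antitone H) (h0 : ∀ y, 0 ≤ H y)
    (h1 : ∀ y, H y ≤ 1) {c : ℝ} (hc : 0 < c) (ho : H =o[atTop] expMix c H)
    (hpos : ∀ y, 0 < y → 0 < expMix c H y) :
    ScalesWith (expMix c H) (-1 / c) := by
  refine scalesWith_of_one_le fun s hs => ?_
  have hs0 : 0 < s := by linarith
  set t := Real.log s / c with ht_def
  have ht : 0 ≤ t := div_nonneg (Real.log_nonneg hs) hc.le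
  have hst : Real.exp (c * t) = s := by
    rw [ht_def, mul_div_cancel₀ _ hc.ne', Real.exp_log hs0]
  have hsp : Real.exp (-t) = s ^ (-1 / c) := by
    rw [Real.rpow_def_of_pos hs0, ht_def]; congr 1; ring
  set B : ℝ → ℝ := fun y => ∫ x in Set.Ioc (-t) 0, Real.exp (-x) * H (y * Real.exp (-(c * x)))
  have hB0 : ∀ y, 0 ≤ B y := fun y =>
    integral_nonneg fun x => mul_nonneg (Real.exp_pos _).le (h0 _)
  have hB : ∀ y, 0 < y → B y ≤ t * Real.exp t * H y := by
    intro y hy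
    have : B y ≤ ∫ x in Set.Ioc (-t) 0, Real.exp t * H y := by
      refine setIntegral_mono_on ((integrableOn_exp_neg_mul_of_antitone hH h0 h1 y c (-t)).mono_set
        Set.Ioc_subset_Ioi_self) (continuousOn_const.integrableOn_Icc.mono_set
          Set.Ioc_subset_Icc_self) measurableSet_Ioc fun x hx => ?_
      refine mul_le_mul (Real.exp_le_exp.2 (by linarith [hx.1])) (hH ?_) (h0 _) (Real.exp_pos _).le
      have : 1 ≤ Real.exp (-(c * x)) := Real.one_le_exp (by nlinarith [hx.2])
      nlinarith
    refine this.trans (le_of_eq ?_)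
    simp [Measure.real, ht, mul_assoc]
  have hlim : Tendsto (fun y => B y / expMix c H y) atTop (𝓝 0) := by
    have h2 := (ho.tendsto_div_nhds_zero).const_mul (t * Real.exp t)
    rw [mul_zero] at h2
    refine tendsto_of_tendsto_of_tendsto_of_le_of_le' tendsto_const_nhds h2 ?_ ?_
    · filter_upwards [eventually_gt_atTop 0] with y hy using div_nonneg (hB0 y) (hpos y hy).le
    · filter_upwards [eventually_gt_atTop 0] with y hy
      rw [← mul_div_assoc]
      exact div_le_div_of_nonneg_right (hB y hy) (hpos y hy).le
  have h3 := (hlim.const_add 1).const_mul (Real.exp (-t))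
  rw [add_zero, mul_one, hsp] at h3
  refine h3.congr' ?_
  filter_upwards [eventually_gt_atTop 0] with y hy
  have := (hpos y hy).ne'
  rw [← hsp, ← hst, expMix_mul_exp hH h0 h1 c t y ht]
  change _ = Real.exp (-t) * (_ + B y) / _
  field_simp

/-- Keep only those `x` for which `exp (c * x)` alone lifts `r` above `y`. -/
theorem rpow_le_expMix {H : ℝ → ℝ} (hH : Antitone H) (h0 : ∀ y, 0 ≤ H y)
    (h1 : ∀ y, H y ≤ 1) {c r y : ℝ} (hc : 0 < c) (hr : 0 < r) (hy : r ≤ y) :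
    H r * (r / y) ^ (1 / c) ≤ expMix c H y := by
  have hy0 : 0 < y := hr.trans_le hy
  set a := Real.log (y / r) / c with ha
  have ha0 : 0 ≤ a := div_nonneg (Real.log_nonneg (by rwa [one_le_div hr])) hc.le
  have hI := integrableOn_exp_neg_mul_of_antitone hH h0 h1 y c 0
  calc H r * (r / y) ^ (1 / c) = ∫ x in Set.Ioi a, Real.exp (-x) * H r := by
        rw [integral_mul_const, integral_exp_neg_Ioi, mul_comm, Real.rpow_def_of_pos (by positivity),
          ha, ← inv_div, Real.log_inv]
        congr 2; ring
    _ ≤ ∫ x in Set.Ioi a, Real.exp (-x) * H (y * Real.exp (-(c * x))) := by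
        refine setIntegral_mono_on ((integrableOn_exp_neg_Ioi a).mul_const _)
          (hI.mono_set (Set.Ioi_subset_Ioi ha0)) measurableSet_Ioi fun x hx => ?_
        refine mul_le_mul_of_nonneg_left (hH ?_) (Real.exp_pos _).le
        have h2 : Real.log (y / r) ≤ c * x := by
          have : a < x := hx
          rw [ha, div_lt_iff₀ hc] at this
          linarith
        have h3 : y / r ≤ Real.exp (c * x) := (Real.log_le_iff_le_exp (by positivity)).1 h2
        rw [Real.exp_neg, ← div_eq_mul_inv, div_le_iff₀ (Real.exp_pos _)]
        rwa [div_le_iff₀ hr, mul_comm] at h3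
    _ ≤ expMix c H y := by
        refine setIntegral_mono_set hI (ae_of_all _ fun x => mul_nonneg (Real.exp_pos _).le (h0 _))
          (Set.Ioi_subset_Ioi ha0).eventuallyLE

theorem isLittleO_expMix_of_le_rpow {H : ℝ → ℝ} (hH : Antitone H) (h0 : ∀ y, 0 ≤ H y)
    (h1 : ∀ y, H y ≤ 1) {c r s C : ℝ} (hc : 0 < c) (hr : 0 < r) (hHr : 0 < H r)
    (hs : 1 / c < s) (hC : ∀ y, 0 < y → H y ≤ C * y ^ (-s)) :
    H =o[atTop] expMix c H := by
  have e1 : H =O[atTop] fun y : ℝ => y ^ (-s) := by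
    refine IsBigO.of_bound C ?_
    filter_upwards [eventually_gt_atTop 0] with y hy
    rw [Real.norm_of_nonneg (h0 y), Real.norm_of_nonneg (Real.rpow_nonneg hy.le _)]
    exact hC y hy
  have e2 : (fun y : ℝ => y ^ (-s)) =o[atTop] fun y : ℝ => y ^ (-(1 / c)) := by
    refine isLittleO_of_tendsto' ?_ ?_
    · filter_upwards [eventually_gt_atTop 0] with y hy h
      exact absurd h (Real.rpow_pos_of_pos hy _).ne'
    · refine (tendsto_rpow_neg_atTop (sub_pos.2 hs)).congr' ?_
      filter_upwards [eventually_gt_atTop 0] with y hy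
      rw [← Real.rpow_sub hy]
      ring_nf
  have e3 : (fun y : ℝ => y ^ (-(1 / c))) =O[atTop] expMix c H := by
    refine IsBigO.of_bound (H r * r ^ (1 / c))⁻¹ ?_
    filter_upwards [eventually_ge_atTop r] with y hy
    have hy0 : 0 < y := hr.trans_le hy
    have h2 := rpow_le_expMix hH h0 h1 hc hr hy
    have hp : 0 < H r * r ^ (1 / c) := mul_pos hHr (Real.rpow_pos_of_pos hr _)
    rw [Real.norm_of_nonneg (Real.rpow_nonneg hy0.le _), ← div_eq_inv_mul, le_div_iff₀ hp]
    refine le_trans (le_of_eq ?_) (h2.trans (le_abs_self _))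
    rw [Real.div_rpow hr.le hy0.le, Real.rpow_neg hy0.le]
    ring
  exact e1.trans_isLittleO (e2.trans_isBigO e3)

/-- On `[j, j + 1]` the argument of `H` is at most `exp (-j) * y`, and the exponential mass of the
interval is `exp (-j) * (1 - exp (-1))`. -/
theorem sum_le_expMix_one {H : ℝ → ℝ} (hH : Antitone H) (h0 : ∀ y, 0 ≤ H y)
    (h1 : ∀ y, H y ≤ 1) {y : ℝ} (hy : 0 ≤ y) (n : ℕ) :
    ∑ j ∈ Finset.range n, Real.exp (-j) * (1 - Real.exp (-1)) * H (Real.exp (-j) * y) ≤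
      expMix 1 H y := by
  have hI := integrableOn_exp_neg_mul_of_antitone hH h0 h1 y 1 0
  have hii : ∀ a b : ℝ, 0 ≤ a → a ≤ b → IntervalIntegrable
      (fun x => Real.exp (-x) * H (y * Real.exp (-(1 * x)))) volume a b := fun a b ha hab =>
    (intervalIntegrable_iff_integrableOn_Ioc_of_le hab).2
      (hI.mono_set fun x hx => lt_of_le_of_lt ha hx.1)
  calc _ ≤ ∑ j ∈ Finset.range n, ∫ x in (j : ℝ)..((j + 1 : ℕ) : ℝ),
          Real.exp (-x) * H (y * Real.exp (-(1 * x))) := by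
        refine Finset.sum_le_sum fun j _ => ?_
        have hj : (j : ℝ) ≤ ((j + 1 : ℕ) : ℝ) := by push_cast; linarith
        have h2 : Real.exp (-j) * (1 - Real.exp (-1)) * H (Real.exp (-j) * y) =
            ∫ x in (j : ℝ)..((j + 1 : ℕ) : ℝ), Real.exp (-x) * H (Real.exp (-j) * y) := by
          rw [intervalIntegral.integral_mul_const,
            intervalIntegral.integral_comp_neg (fun x => Real.exp x), integral_exp]
          push_cast
          rw [show -((j : ℝ) + 1) = -j + -1 by ring, Real.exp_add]
          ring
        rw [h2]
        refine intervalIntegral.integral_mono_on hj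
          (Continuous.intervalIntegrable (by fun_prop) _ _) (hii _ _ (by positivity) hj) ?_
        intro x hx
        refine mul_le_mul_of_nonneg_left (hH ?_) (Real.exp_pos _).le
        rw [mul_comm]
        refine mul_le_mul_of_nonneg_right (Real.exp_le_exp.2 ?_) hy
        linarith [hx.1]
    _ = ∫ x in (0 : ℝ)..n, Real.exp (-x) * H (y * Real.exp (-(1 * x))) := by
        have := intervalIntegral.sum_integral_adjacent_intervals (a := fun k : ℕ => (k : ℝ))
          (μ := volume) (f := fun x => Real.exp (-x) * H (y * Real.exp (-(1 * x)))) (n := n)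
          (fun k _ => hii _ _ (by positivity) (by push_cast; linarith))
        simpa using this
    _ ≤ expMix 1 H y := by
        rw [intervalIntegral.integral_of_le (by positivity)]
        exact setIntegral_mono_set hI
          (ae_of_all _ fun x => mul_nonneg (Real.exp_pos _).le (h0 _))
          Set.Ioc_subset_Ioi_self.eventuallyLE

/-- For index `-1` the weight `exp (-j)` cancels the growth of `H (exp (-j) * y) / H y`, so each
unit interval contributes asymptotically at least `(1 - exp (-1)) * H y`; the number of intervals is
arbitrary. -/
theorem isLittleO_expMix_of_scalesWith {H : ℝ → ℝ} (hH : Antitone H) (h0 : ∀ y, 0 < H y)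
    (h1 : ∀ y, H y ≤ 1) (hs : ScalesWith H (-1)) : H =o[atTop] expMix 1 H := by
  rw [isLittleO_iff]
  intro ε hε
  obtain ⟨n, hn⟩ := exists_nat_gt (ε⁻¹ / (1 - Real.exp (-1)))
  have hq : 0 < 1 - Real.exp (-1) := by
    rw [sub_pos]; exact Real.exp_lt_one_iff.2 (by norm_num)
  have hlim : Tendsto (fun y => ∑ j ∈ Finset.range n,
      Real.exp (-j) * (1 - Real.exp (-1)) * (H (Real.exp (-j) * y) / H y)) atTop
      (𝓝 (∑ j ∈ Finset.range n, Real.exp (-j) * (1 - Real.exp (-1)) * Real.exp (-j) ^ (-1 : ℝ))) :=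
    tendsto_finsetSum _ fun j _ => (hs _ (Real.exp_pos _)).const_mul _
  have hval : ∑ j ∈ Finset.range n, Real.exp (-j) * (1 - Real.exp (-1)) * Real.exp (-j) ^ (-1 : ℝ)
      = n * (1 - Real.exp (-1)) := by
    rw [Finset.sum_congr rfl (g := fun _ => 1 - Real.exp (-1))]
    · simp [mul_sub]
    · intro j _
      rw [Real.rpow_neg_one, mul_right_comm, mul_inv_cancel₀ (Real.exp_pos _).ne', one_mul]
  rw [hval] at hlim
  have hlt : ε⁻¹ < n * (1 - Real.exp (-1)) := by rwa [div_lt_iff₀ hq] at hn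
  filter_upwards [hlim.eventually (lt_mem_nhds hlt), eventually_ge_atTop 0] with y hy hy0
  have h2 := sum_le_expMix_one hH (fun y => (h0 y).le) h1 hy0 n
  have h3 : ε⁻¹ * H y < expMix 1 H y := by
    refine lt_of_lt_of_le ?_ h2
    rw [← lt_div_iff₀ (h0 y), Finset.sum_div]
    simpa only [mul_div_assoc] using hy
  rw [Real.norm_of_nonneg (h0 y).le]
  refine le_trans ?_ (mul_le_mul_of_nonneg_left (h3.le.trans (le_abs_self _)) hε.le)
  rw [← mul_assoc, mul_inv_cancel₀ hε.ne', one_mul]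

/-! ### Quantiles and regular variation -/

section Quantile

variable {ν : Measure ℝ}

theorem measureReal_Ioi_eq_one_sub_cdf (ν : Measure ℝ) [IsProbabilityMeasure ν] (y : ℝ) :
    ν.real (Set.Ioi y) = 1 - cdf ν y := by
  rw [cdf_eq_real, ← Set.compl_Iic, probReal_compl_eq_one_sub measurableSet_Iic]

theorem bddBelow_setOf_le_cdf {p : ℝ} (hp : 0 < p) : BddBelow {y : ℝ | p ≤ cdf ν y} := by
  obtain ⟨a, ha⟩ := ((tendsto_cdf_atBot ν).eventually (gt_mem_nhds hp)).exists
  refine ⟨a, fun y hy => ?_⟩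
  by_contra! h
  exact absurd (le_trans hy (monotone_cdf ν h.le)) (not_le.2 ha)

theorem nonempty_setOf_le_cdf {p : ℝ} (hp : p < 1) : {y : ℝ | p ≤ cdf ν y}.Nonempty := by
  obtain ⟨a, ha⟩ := ((tendsto_cdf_atTop ν).eventually (lt_mem_nhds hp)).exists
  exact ⟨a, ha.le⟩

theorem le_cdf_quantileFn {p : ℝ} (hp : p < 1) : p ≤ cdf ν (quantileFn ν p) := by
  have hc := (cdf ν).right_continuous (quantileFn ν p)
  have hc' : Tendsto (cdf ν) (𝓝[>] (quantileFn ν p)) (𝓝 (cdf ν (quantileFn ν p))) :=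
    hc.mono_left (nhdsWithin_mono _ Set.Ioi_subset_Ici_self)
  refine ge_of_tendsto hc' ?_
  filter_upwards [self_mem_nhdsWithin] with z hz
  obtain ⟨y, hy, hyz⟩ := exists_lt_of_csInf_lt (nonempty_setOf_le_cdf hp) hz
  exact le_trans hy (monotone_cdf ν hyz.le)

variable [IsProbabilityMeasure ν]

theorem one_sub_one_div_mem {x : ℝ} (hx : 1 < x) : 0 < 1 - 1 / x ∧ 1 - 1 / x < 1 := by
  have h0 : 0 < x := by linarith
  have : 1 / x < 1 := (div_lt_one h0).2 hx
  have : 0 < 1 / x := by positivity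
  constructor <;> linarith

theorem measureReal_Ioi_quantileFn_le {x : ℝ} (hx : 1 < x) :
    ν.real (Set.Ioi (quantileFn ν (1 - 1 / x))) ≤ 1 / x := by
  rw [measureReal_Ioi_eq_one_sub_cdf]
  linarith [le_cdf_quantileFn (ν := ν) (one_sub_one_div_mem hx).2]

theorem quantileFn_le_of_measureReal_Ioi_le {x z : ℝ} (hx : 1 < x)
    (hz : ν.real (Set.Ioi z) ≤ 1 / x) : quantileFn ν (1 - 1 / x) ≤ z := by
  rw [measureReal_Ioi_eq_one_sub_cdf] at hz
  exact csInf_le (bddBelow_setOf_le_cdf (one_sub_one_div_mem hx).1)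
    (show 1 - 1 / x ≤ cdf ν z by linarith)

theorem monotoneOn_quantileFn :
    MonotoneOn (fun x => quantileFn ν (1 - 1 / x)) (Set.Ioi 1) := by
  intro x hx y hy hxy
  have hx' : (1 : ℝ) < x := hx
  refine quantileFn_le_of_measureReal_Ioi_le hx ((measureReal_Ioi_quantileFn_le hy).trans ?_)
  exact one_div_le_one_div_of_le (by linarith) hxy

theorem tendsto_quantileFn_atTop (hpos : ∀ y, 0 < ν.real (Set.Ioi y)) :
    Tendsto (fun x => quantileFn ν (1 - 1 / x)) atTop atTop := by
  rw [tendsto_atTop]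
  intro M
  filter_upwards [eventually_gt_atTop 1, eventually_gt_atTop (1 / ν.real (Set.Ioi M))] with x h1 h2
  by_contra! h
  have h3 := measureReal_Ioi_quantileFn_le (ν := ν) h1
  have h4 : ν.real (Set.Ioi M) ≤ 1 / x :=
    (measureReal_mono (Set.Ioi_subset_Ioi h.le)).trans h3
  rw [div_lt_iff₀ (hpos M)] at h2
  rw [le_div_iff₀ (by linarith)] at h4
  linarith

/-- Only an inequality with slack `s < r` is needed, so no continuity of the distribution function
enters: the tail at `r` times the quantile is eventually below `s⁻¹` times the tail at the quantile,
which is at most `1 / x`. -/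
theorem eventually_quantileFn_le (hpos : ∀ y, 0 < ν.real (Set.Ioi y))
    (hG : ScalesWith (fun y => ν.real (Set.Ioi y)) (-1)) {s r : ℝ} (hs : 0 < s) (hr : s < r) :
    ∀ᶠ x in atTop, quantileFn ν (1 - 1 / (s * x)) ≤ r * quantileFn ν (1 - 1 / x) := by
  have hr0 : 0 < r := hs.trans hr
  have h1 := (hG r hr0).comp (tendsto_quantileFn_atTop hpos)
  have h2 : r ^ (-1 : ℝ) < s⁻¹ := by
    rw [Real.rpow_neg_one]; exact (inv_lt_inv₀ hr0 hs).2 hr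
  filter_upwards [h1.eventually (gt_mem_nhds h2), eventually_gt_atTop 1,
    eventually_gt_atTop s⁻¹] with x h3 hx hsx
  have hx0 : 0 < x := by linarith
  have hsx' : 1 < s * x := by rwa [inv_lt_iff_one_lt_mul₀ hs, mul_comm] at hsx
  refine quantileFn_le_of_measureReal_Ioi_le hsx' ?_
  have h4 := measureReal_Ioi_quantileFn_le (ν := ν) hx
  simp only [Function.comp_apply] at h3
  rw [div_lt_iff₀ (hpos _)] at h3
  refine h3.le.trans ?_
  rw [show 1 / (s * x) = s⁻¹ * (1 / x) by rw [one_div, mul_inv, one_div]]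
  exact mul_le_mul_of_nonneg_left h4 (inv_pos.2 hs).le

/-- Sandwich the quantile at `s * x` between multiples of the quantile at `x` by factors `r` near
`s`, and use continuity of `r ↦ r ^ ρ`. -/
theorem isRegularlyVarying_comp_quantileFn (hpos : ∀ y, 0 < ν.real (Set.Ioi y))
    (hG : ScalesWith (fun y => ν.real (Set.Ioi y)) (-1)) {J : ℝ → ℝ} {ρ : ℝ} (hJ : Antitone J)
    (hJpos : ∀ y, 0 < J y) (hJs : ScalesWith J ρ) :
    IsRegularlyVarying (fun x => J (quantileFn ν (1 - 1 / x))) ρ := by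
  -- The level `1 - 1 / x` lies in `(0, 1)` only for `x > 1`; any half-line starting above `1` would
  -- do.
  refine ⟨⟨2, ?_, fun x _ => hJpos _⟩, fun s hs => ?_⟩
  · refine Antitone.measurable fun x y hxy => hJ (monotoneOn_quantileFn ?_ ?_ hxy)
    · exact one_lt_two.trans_le (Set.mem_Ici.1 x.2)
    · exact one_lt_two.trans_le (Set.mem_Ici.1 y.2)
  have hq := tendsto_quantileFn_atTop hpos
  have hcont : ContinuousAt (fun r : ℝ => r ^ ρ) s :=
    Real.continuousAt_rpow_const _ _ (Or.inl hs.ne')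
  have hsx : Tendsto (fun x : ℝ => s * x) atTop atTop := tendsto_id.const_mul_atTop hs
  have hpow : Tendsto (fun r : ℝ => r ^ ρ) (𝓝 s) (𝓝 (s ^ ρ)) := hcont
  rw [tendsto_order]
  constructor
  · intro a ha
    obtain ⟨r, hr1, hr2⟩ := (((hpow.mono_left nhdsWithin_le_nhds).eventually
      (lt_mem_nhds ha)).and (self_mem_nhdsWithin (s := Set.Ioi s))).exists
    have hr : s < r := hr2
    filter_upwards [eventually_quantileFn_le hpos hG hs hr,
      ((hJs r (hs.trans hr)).comp hq).eventually (lt_mem_nhds hr1)] with x h1 h2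
    exact lt_of_lt_of_le h2 (div_le_div_of_nonneg_right (hJ h1) (hJpos _).le)
  · intro a ha
    have h0 : ∀ᶠ r in 𝓝[<] s, 0 < r := nhdsWithin_le_nhds (lt_mem_nhds hs)
    obtain ⟨r, ⟨hr1, hr2⟩, hr0⟩ := ((((hpow.mono_left nhdsWithin_le_nhds).eventually
      (gt_mem_nhds ha)).and (self_mem_nhdsWithin (s := Set.Iio s))).and h0).exists
    have hr : r < s := hr2
    have hinv : s⁻¹ < r⁻¹ := (inv_lt_inv₀ hs hr0).2 hr
    -- The lower bound for the quantile at `s * x` is the upper bound for `s⁻¹`, read at the point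
    -- `s * x`.
    filter_upwards [hsx.eventually (eventually_quantileFn_le hpos hG (inv_pos.2 hs) hinv),
      ((hJs r hr0).comp hq).eventually (gt_mem_nhds hr1)] with x h1 h2
    rw [inv_mul_cancel_left₀ hs.ne', ← div_eq_inv_mul, le_div_iff₀ hr0, mul_comm] at h1
    exact lt_of_le_of_lt (div_le_div_of_nonneg_right (hJ h1) (hJpos _).le) h2

end Quantile

/-! ### The standard exponential law -/

theorem integral_expMeasure_one (f : ℝ → ℝ) :
    ∫ x, f x ∂(expMeasure 1) = ∫ x in Set.Ioi 0, Real.exp (-x) * f x := by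
  have hm : Measurable (gammaPDF 1 1) := (measurable_gammaPDFReal 1 1).ennreal_ofReal
  rw [expMeasure, gammaMeasure, integral_withDensity_eq_integral_toReal_smul hm
    (ae_of_all _ fun x => ENNReal.ofReal_lt_top), ← integral_Ici_eq_integral_Ioi,
    ← integral_indicator measurableSet_Ici]
  congr 1
  ext x
  have h : gammaPDF 1 1 x = exponentialPDF 1 x := rfl
  rw [h, exponentialPDF_eq]
  by_cases hx : 0 ≤ x
  · rw [if_pos hx, Set.indicator_of_mem (show x ∈ Set.Ici 0 from hx), ENNReal.toReal_ofReal]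
    · simp
    · positivity
  · rw [if_neg hx, Set.indicator_of_notMem (show x ∉ Set.Ici 0 from hx)]
    simp

theorem integrable_expMeasure_one_iff (f : ℝ → ℝ) :
    Integrable f (expMeasure 1) ↔ IntegrableOn (fun x => Real.exp (-x) * f x) (Set.Ioi 0) := by
  have hm : Measurable (gammaPDF 1 1) := (measurable_gammaPDFReal 1 1).ennreal_ofReal
  rw [expMeasure, gammaMeasure, integrable_withDensity_iff_integrable_smul' hm
    (ae_of_all _ fun x => ENNReal.ofReal_lt_top), ← integrableOn_Ici_iff_integrableOn_Ioi,
    ← integrable_indicator_iff measurableSet_Ici]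
  refine integrable_congr (ae_of_all _ fun x => ?_)
  have h : gammaPDF 1 1 x = exponentialPDF 1 x := rfl
  simp only [h, exponentialPDF_eq]
  by_cases hx : 0 ≤ x
  · rw [if_pos hx, Set.indicator_of_mem (show x ∈ Set.Ici 0 from hx), ENNReal.toReal_ofReal]
    · simp
    · positivity
  · rw [if_neg hx, Set.indicator_of_notMem (show x ∉ Set.Ici 0 from hx)]
    simp

instance isProbabilityMeasure_expMeasure_one : IsProbabilityMeasure (expMeasure 1) :=
  isProbabilityMeasure_expMeasure one_pos

theorem integrable_exp_mul_expMeasure {b : ℝ} (hb : b < 1) :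
    Integrable (fun x => Real.exp (b * x)) (expMeasure 1) := by
  rw [integrable_expMeasure_one_iff]
  refine (exp_neg_integrableOn_Ioi 0 (sub_pos.2 hb)).congr_fun (fun x _ => ?_) measurableSet_Ioi
  simp only [← Real.exp_add]
  congr 1; ring

theorem ae_nonneg_expMeasure : ∀ᵐ x ∂(expMeasure 1), 0 ≤ x := by
  have h : (expMeasure 1).real (Set.Iic 0) = 0 := by
    rw [← cdf_eq_real, cdf_expMeasure_eq one_pos]; simp
  rw [measureReal_eq_zero_iff] at h
  exact (measure_eq_zero_iff_ae_notMem.1 h).mono fun x hx => (not_le.1 hx).le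

theorem integrable_sq_expMeasure : Integrable (fun x => x ^ 2) (expMeasure 1) := by
  -- The constant `8` comes from `(x / 2) ^ 2 / 2 ≤ exp (x / 2)`.
  refine ((integrable_exp_mul_expMeasure (b := 1 / 2) (by norm_num)).const_mul 8).mono'
    (by fun_prop) ?_
  filter_upwards [ae_nonneg_expMeasure] with x hx
  rw [Real.norm_of_nonneg (sq_nonneg x)]
  have := Real.quadratic_le_exp_of_nonneg (show 0 ≤ 1 / 2 * x by positivity)
  nlinarith

theorem measureReal_Ioi_expMeasure {z : ℝ} (hz : 0 ≤ z) :
    (expMeasure 1).real (Set.Ioi z) = Real.exp (-z) := by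
  rw [measureReal_Ioi_eq_one_sub_cdf, cdf_expMeasure_eq one_pos, if_pos hz]
  simp

/-! ### Products with an independent exponential factor -/

section Tails

variable {Ω : Type*} [MeasurableSpace Ω] {P : Measure Ω} [IsProbabilityMeasure P]

/-- Fubini, conditioning on `E`. One-variable tails are the case `A = B`. -/
theorem measureReal_mul_exp_eq_expMix {A B E : Ω → ℝ} (hA : Measurable A) (hB : Measurable B)
    (hE : HasLaw E (expMeasure 1) P) (hi : IndepFun (fun ω => (A ω, B ω)) E P) (c y : ℝ) :
    P.real {ω | y < A ω * Real.exp (c * E ω) ∧ y < B ω * Real.exp (c * E ω)} =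
      expMix c (fun z => P.real {ω | z < A ω ∧ z < B ω}) y := by
  have hAB : Measurable fun ω => (A ω, B ω) := hA.prodMk hB
  have hmap := (indepFun_iff_map_prod_eq_prod_map_map hAB.aemeasurable hE.aemeasurable).1 hi
  rw [hE.map_eq] at hmap
  set T : Set ((ℝ × ℝ) × ℝ) :=
    {p | y < p.1.1 * Real.exp (c * p.2) ∧ y < p.1.2 * Real.exp (c * p.2)} with hT
  have hTm : MeasurableSet T := by
    rw [hT, Set.ofPred_and]
    exact (measurableSet_lt (by fun_prop) (by fun_prop)).inter
      (measurableSet_lt (by fun_prop) (by fun_prop))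
  have h1 : P {ω | y < A ω * Real.exp (c * E ω) ∧ y < B ω * Real.exp (c * E ω)} =
      P.map (fun ω => ((A ω, B ω), E ω)) T := by
    rw [Measure.map_apply_of_aemeasurable (hAB.aemeasurable.prodMk hE.aemeasurable) hTm]
    rfl
  have : IsProbabilityMeasure (P.map fun ω => (A ω, B ω)) :=
    Measure.isProbabilityMeasure_map hAB.aemeasurable
  rw [measureReal_def, h1, hmap, Measure.prod_apply_symm hTm, ← integral_toReal
    (measurable_measure_prodMk_right hTm).aemeasurable (ae_of_all _ fun x => measure_lt_top _ _),
    integral_expMeasure_one, expMix]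
  congr 1
  ext x
  rw [Measure.map_apply hAB (measurable_prodMk_right hTm), measureReal_def]
  congr 3
  ext ω
  have key : ∀ a : ℝ, y < a * Real.exp (c * x) ↔ y * Real.exp (-(c * x)) < a := fun a => by
    rw [Real.exp_neg, ← div_eq_mul_inv, div_lt_iff₀ (Real.exp_pos _)]
  simp [hT, key]

theorem antitone_measureReal_lt (A B : Ω → ℝ) :
    Antitone fun z => P.real {ω | z < A ω ∧ z < B ω} :=
  fun _ _ h => measureReal_mono fun _ hω => ⟨h.trans_lt hω.1, h.trans_lt hω.2⟩

theorem measureReal_lt_le_of_integrable_rpow {R : Ω → ℝ} {s y : ℝ} (hs : 0 < s)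
    (hR : Integrable (fun ω => |R ω| ^ s) P) (hy : 0 < y) :
    P.real {ω | y < R ω} ≤ (∫ ω, |R ω| ^ s ∂P) * y ^ (-s) := by
  have h := mul_meas_ge_le_integral_of_nonneg
    (ae_of_all _ fun ω => Real.rpow_nonneg (abs_nonneg (R ω)) s) hR (y ^ s)
  have hp : 0 < y ^ s := Real.rpow_pos_of_pos hy s
  rw [Real.rpow_neg hy.le, ← div_eq_mul_inv, le_div_iff₀ hp, mul_comm]
  refine le_trans (mul_le_mul_of_nonneg_left (measureReal_mono fun ω hω => ?_) hp.le) h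
  exact Real.rpow_le_rpow hy.le ((le_of_lt hω).trans (le_abs_self _)) hs.le

/-- The two alternatives in `h` serve an induction over the factors with coefficient `1`: the moment
bound starts it, and the scaling, which is also the conclusion, continues it. -/
theorem scalesWith_measureReal_mul_exp {R E : Ω → ℝ} (hR : Measurable R)
    (hE : HasLaw E (expMeasure 1) P) (hi : IndepFun R E P)
    (hr : ∃ r : ℝ, 0 < r ∧ 0 < P.real {ω | r < R ω})
    (h : (∃ s : ℝ, 1 < s ∧ Integrable (fun ω => |R ω| ^ s) P) ∨
      ((∀ y, 0 < P.real {ω | y < R ω}) ∧ ScalesWith (fun y => P.real {ω | y < R ω}) (-1))) :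
    (∀ y, 0 < P.real {ω | y < R ω * Real.exp (E ω)}) ∧
      ScalesWith (fun y => P.real {ω | y < R ω * Real.exp (E ω)}) (-1) := by
  set H : ℝ → ℝ := fun y => P.real {ω | y < R ω}
  have hH : Antitone H := by simpa using antitone_measureReal_lt (P := P) R R
  have h0 : ∀ y, 0 ≤ H y := fun y => measureReal_nonneg
  have h1 : ∀ y, H y ≤ 1 := fun y => measureReal_le_one
  obtain ⟨r, hr0, hr⟩ := hr
  have heq : (fun y => P.real {ω | y < R ω * Real.exp (E ω)}) = expMix 1 H := by
    ext y
    simpa using measureReal_mul_exp_eq_expMix hR hR hE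
      (hi.comp (φ := fun x : ℝ => (x, x)) (ψ := id) (by fun_prop) measurable_id) 1 y
  have hpos : ∀ y, 0 < P.real {ω | y < R ω * Real.exp (E ω)} := by
    intro y
    -- The power lower bound holds only from `r` on; monotonicity of the tail covers smaller `y`.
    have h2 : 0 < expMix 1 H (max r y) := lt_of_lt_of_le (mul_pos hr (by positivity))
      (rpow_le_expMix hH h0 h1 one_pos hr0 (le_max_left _ _))
    rw [← heq] at h2
    exact h2.trans_le (measureReal_mono fun ω (hω : max r y < _) =>
      show y < _ from (le_max_right _ _).trans_lt hω)
  refine ⟨hpos, ?_⟩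
  have ho : H =o[atTop] expMix 1 H := by
    rcases h with ⟨s, hs, hint⟩ | ⟨hp, hsc⟩
    · exact isLittleO_expMix_of_le_rpow hH h0 h1 one_pos hr0 hr (by simpa using hs)
        fun y hy => measureReal_lt_le_of_integrable_rpow (by linarith) hint hy
    · exact isLittleO_expMix_of_scalesWith hH hp h1 hsc
  rw [heq]
  have := scalesWith_expMix hH h0 h1 one_pos ho fun y _ => by rw [← heq]; exact hpos y
  simpa using this

/-- By independence the tail of `min(A, B)` factorises, so moments of order `s` of each variable
give decay of order `2 s`; this suffices even when `s < 1 / c`. -/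
theorem scalesWith_measureReal_mul_exp_and {A B E : Ω → ℝ} (hA : Measurable A) (hB : Measurable B)
    (hE : HasLaw E (expMeasure 1) P) (hi : IndepFun (fun ω => (A ω, B ω)) E P)
    (hAB : IndepFun A B P) {c s : ℝ} (hc : 0 < c) (hs : 0 < s) (hcs : 1 / c < s + s)
    (hAr : ∃ r : ℝ, 0 < r ∧ 0 < P.real {ω | r < A ω})
    (hBr : ∃ r : ℝ, 0 < r ∧ 0 < P.real {ω | r < B ω})
    (hAs : Integrable (fun ω => |A ω| ^ s) P) (hBs : Integrable (fun ω => |B ω| ^ s) P) :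
    (∀ y, 0 < P.real {ω | y < A ω * Real.exp (c * E ω) ∧ y < B ω * Real.exp (c * E ω)}) ∧
      ScalesWith (fun y =>
        P.real {ω | y < A ω * Real.exp (c * E ω) ∧ y < B ω * Real.exp (c * E ω)}) (-1 / c) := by
  set H : ℝ → ℝ := fun y => P.real {ω | y < A ω ∧ y < B ω} with hHdef
  have hHmul : ∀ y, H y = P.real {ω | y < A ω} * P.real {ω | y < B ω} := fun y => by
    simp only [hHdef, measureReal_def, ← ENNReal.toReal_mul]
    congr 1
    exact hAB.measure_inter_preimage_eq_mul (Set.Ioi y) (Set.Ioi y) measurableSet_Ioi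
      measurableSet_Ioi
  have hH : Antitone H := antitone_measureReal_lt A B
  have h0 : ∀ y, 0 ≤ H y := fun y => measureReal_nonneg
  have h1 : ∀ y, H y ≤ 1 := fun y => measureReal_le_one
  obtain ⟨r₁, hr₁, hA'⟩ := hAr
  obtain ⟨r₂, hr₂, hB'⟩ := hBr
  set r := min r₁ r₂
  have hr0 : 0 < r := lt_min hr₁ hr₂
  have hr : 0 < H r := by
    rw [hHmul]
    exact mul_pos
      (hA'.trans_le (measureReal_mono fun ω (hω : _ < _) =>
        show r < A ω from (min_le_left _ _).trans_lt hω))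
      (hB'.trans_le (measureReal_mono fun ω (hω : _ < _) =>
        show r < B ω from (min_le_right _ _).trans_lt hω))
  have heq : (fun y => P.real {ω | y < A ω * Real.exp (c * E ω) ∧
      y < B ω * Real.exp (c * E ω)}) = expMix c H := by
    ext y
    exact measureReal_mul_exp_eq_expMix hA hB hE hi c y
  have hpos : ∀ y, 0 < expMix c H y := by
    intro y
    have h2 : 0 < expMix c H (max r y) := lt_of_lt_of_le (mul_pos hr (by positivity))
      (rpow_le_expMix hH h0 h1 hc hr0 (le_max_left _ _))
    refine h2.trans_le ?_
    rw [← heq]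
    exact antitone_measureReal_lt _ _ (le_max_right _ _)
  have ho : H =o[atTop] expMix c H := by
    refine isLittleO_expMix_of_le_rpow hH h0 h1 hc hr0 hr hcs
      (C := (∫ ω, |A ω| ^ s ∂P) * ∫ ω, |B ω| ^ s ∂P) fun y hy => ?_
    rw [hHmul, neg_add, Real.rpow_add hy, mul_mul_mul_comm]
    exact mul_le_mul (measureReal_lt_le_of_integrable_rpow hs hAs hy)
      (measureReal_lt_le_of_integrable_rpow hs hBs hy) measureReal_nonneg
      (mul_nonneg (integral_nonneg fun _ => by positivity) (by positivity))
  exact ⟨fun y => by rw [congrFun heq y]; exact hpos y,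
    heq ▸ scalesWith_expMix hH h0 h1 hc ho fun y _ => hpos y⟩

end Tails

/-! ### The probability space of innovations -/

/-- The laws of the innovations: standard exponential for the log-volatility (left summand),
standard Gaussian for the returns (right summand). -/
def innovLaw : ℤ ⊕ ℤ → Measure ℝ :=
  Sum.elim (fun _ => expMeasure 1) (fun _ => gaussianReal 0 1)

instance isProbabilityMeasure_innovLaw (j : ℤ ⊕ ℤ) : IsProbabilityMeasure (innovLaw j) := by
  cases j
  · exact isProbabilityMeasure_expMeasure_one
  · exact inferInstanceAs (IsProbabilityMeasure (gaussianReal 0 1))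

/-- The joint law of all innovations. -/
def innovMeasure : Measure (ℤ ⊕ ℤ → ℝ) := Measure.infinitePi innovLaw

instance isProbabilityMeasure_innovMeasure : IsProbabilityMeasure innovMeasure :=
  inferInstanceAs (IsProbabilityMeasure (Measure.infinitePi innovLaw))

theorem hasLaw_eval_innovMeasure (j : ℤ ⊕ ℤ) :
    HasLaw (fun ω : ℤ ⊕ ℤ → ℝ => ω j) (innovLaw j) innovMeasure :=
  ⟨(measurable_pi_apply j).aemeasurable, (measurePreserving_eval_infinitePi innovLaw j).map_eq⟩

theorem iIndepFun_eval_innovMeasure :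
    iIndepFun (fun (j : ℤ ⊕ ℤ) (ω : ℤ ⊕ ℤ → ℝ) => ω j) innovMeasure :=
  iIndepFun_infinitePi (X := fun _ => id) fun _ => measurable_id

theorem indepFun_of_dependsOn {β γ : Type*} [MeasurableSpace β] [MeasurableSpace γ]
    {f : (ℤ ⊕ ℤ → ℝ) → β} {g : (ℤ ⊕ ℤ → ℝ) → γ} (hf : Measurable f) (hg : Measurable g)
    {S T : Finset (ℤ ⊕ ℤ)} (hST : Disjoint S T) (hfS : DependsOn f S) (hgT : DependsOn g T) :
    IndepFun f g innovMeasure := by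
  have h := iIndepFun_eval_innovMeasure.indepFun_finset S T hST fun j => measurable_pi_apply j
  -- Extension by zero makes `f` and `g` measurable functions of the restrictions to `S` and `T`.
  let ext : (U : Finset (ℤ ⊕ ℤ)) → (U → ℝ) → (ℤ ⊕ ℤ → ℝ) :=
    fun U z j => if hj : j ∈ U then z ⟨j, hj⟩ else 0
  have hext : ∀ U, Measurable (ext U) := fun U => by
    refine measurable_pi_iff.2 fun j => ?_
    by_cases hj : j ∈ U
    · simp only [ext, hj, dite_true]; exact measurable_pi_apply _
    · simp only [ext, hj, dite_false]; exact measurable_const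
  have h2 := h.comp (hf.comp (hext S)) (hg.comp (hext T))
  have e1 : (f ∘ ext S) ∘ (fun (ω : ℤ ⊕ ℤ → ℝ) (i : S) => ω i) = f := by
    ext ω
    refine hfS fun j hj => ?_
    have hj' : j ∈ S := hj
    simp [ext, hj']
  have e2 : (g ∘ ext T) ∘ (fun (ω : ℤ ⊕ ℤ → ℝ) (i : T) => ω i) = g := by
    ext ω
    refine hgT fun j hj => ?_
    have hj' : j ∈ T := hj
    simp [ext, hj']
  rwa [e1, e2] at h2

/-! ### Tails of finite volatility products -/

/-- The product of the return factor `u (ε_t)` and the volatility factors `exp (b_n ξ_n)`,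
`n ∈ S`. -/
def volProd (u : ℝ → ℝ) (b : ℤ → ℝ) (t : ℤ) (S : Finset ℤ) (ω : ℤ ⊕ ℤ → ℝ) : ℝ :=
  u (ω (Sum.inr t)) * ∏ n ∈ S, Real.exp (b n * ω (Sum.inl n))

section VolProd

variable {u : ℝ → ℝ} {b : ℤ → ℝ} {t t' : ℤ} {S S' : Finset ℤ}

theorem measurable_volProd (hu : Measurable u) (b : ℤ → ℝ) (t : ℤ) (S : Finset ℤ) :
    Measurable (volProd u b t S) := by
  unfold volProd
  refine (hu.comp (measurable_pi_apply _)).mul (Finset.measurable_prod _ fun n _ => ?_)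
  fun_prop

theorem volProd_insert {n : ℤ} (hn : n ∉ S) (ω : ℤ ⊕ ℤ → ℝ) :
    volProd u b t (insert n S) ω = volProd u b t S ω * Real.exp (b n * ω (Sum.inl n)) := by
  rw [volProd, volProd, Finset.prod_insert hn]; ring

theorem dependsOn_volProd (u : ℝ → ℝ) (b : ℤ → ℝ) (t : ℤ) (S : Finset ℤ) :
    DependsOn (volProd u b t S) (S.disjSum {t} : Finset (ℤ ⊕ ℤ)) := by
  intro ω ω' h
  unfold volProd
  rw [h (Sum.inr t) (by simp)]
  congr 1
  exact Finset.prod_congr rfl fun n hn => by rw [h (Sum.inl n) (by simpa using hn)]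

theorem indepFun_volProd (hu : Measurable u) (htt : t ≠ t') (hS : Disjoint S S') :
    IndepFun (volProd u b t S) (volProd u b t' S') innovMeasure := by
  refine indepFun_of_dependsOn (measurable_volProd hu b t S) (measurable_volProd hu b t' S') ?_
    (dependsOn_volProd u b t S) (dependsOn_volProd u b t' S')
  rw [Finset.disjoint_left] at hS ⊢
  rintro (n | n) h1 h2
  · simp only [Finset.inl_mem_disjSum] at h1 h2; exact hS h1 h2
  · simp only [Finset.inr_mem_disjSum, Finset.mem_singleton] at h1 h2; exact htt (h1.symm.trans h2)

theorem indepFun_volProd_prodMk_eval (hu : Measurable u) {w : ℤ} (hw : w ∉ S) (hw' : w ∉ S') :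
    IndepFun (fun ω => (volProd u b t S ω, volProd u b t' S' ω))
      (fun ω : ℤ ⊕ ℤ → ℝ => ω (Sum.inl w)) innovMeasure := by
  refine indepFun_of_dependsOn ((measurable_volProd hu b t S).prodMk (measurable_volProd hu b t' S'))
    (measurable_pi_apply _) (S := S.disjSum {t} ∪ S'.disjSum {t'}) (T := {Sum.inl w}) ?_ ?_ ?_
  · simp [hw, hw']
  · intro ω ω' h
    simp only [Prod.mk.injEq]
    exact ⟨dependsOn_volProd u b t S fun j hj => h j (by simpa using Or.inl hj),
      dependsOn_volProd u b t' S' fun j hj => h j (by simpa using Or.inr hj)⟩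
  · intro ω ω' h
    exact h _ (by simp)

theorem indepFun_volProd_eval (hu : Measurable u) {w : ℤ} (hw : w ∉ S) :
    IndepFun (volProd u b t S) (fun ω : ℤ ⊕ ℤ → ℝ => ω (Sum.inl w)) innovMeasure :=
  (indepFun_volProd_prodMk_eval hu hw hw (t' := t)).comp measurable_fst measurable_id

/-- The factors are independent, and `exp (s * b n * x)` is integrable for the exponential law when
`s * b n < 1`. -/
theorem integrable_volProd_rpow (hu : Measurable u) {s : ℝ}
    (hus : Integrable (fun x => |u x| ^ s) (gaussianReal 0 1)) (hb : ∀ n ∈ S, s * b n < 1) :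
    Integrable (fun ω => |volProd u b t S ω| ^ s) innovMeasure := by
  induction S using Finset.induction_on with
  | empty =>
    have h := (hasLaw_eval_innovMeasure (Sum.inr t))
    have h2 : Integrable (fun x => |u x| ^ s) (innovMeasure.map fun ω => ω (Sum.inr t)) := by
      rw [h.map_eq]; exact hus
    simpa [volProd, Function.comp_def] using h2.comp_aemeasurable h.aemeasurable
  | insert n S hn ih =>
    have ih' := ih fun k hk => hb k (Finset.mem_insert_of_mem hk)
    have h := (hasLaw_eval_innovMeasure (Sum.inl n))
    have h2 : Integrable (fun x => Real.exp (s * b n * x))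
        (innovMeasure.map fun ω => ω (Sum.inl n)) := by
      rw [h.map_eq]; exact integrable_exp_mul_expMeasure (hb n (Finset.mem_insert_self n S))
    have hind := (indepFun_volProd_eval (b := b) (t := t) hu hn).comp
      (φ := fun x : ℝ => |x| ^ s) (ψ := fun x : ℝ => Real.exp (s * b n * x))
      (by fun_prop) (by fun_prop)
    refine (hind.integrable_mul ih' (h2.comp_aemeasurable h.aemeasurable)).congr
      (ae_of_all _ fun ω => ?_)
    simp only [Pi.mul_apply, Function.comp_apply]
    rw [volProd_insert hn, abs_mul, Real.mul_rpow (abs_nonneg _) (abs_nonneg _), Real.abs_exp,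
      ← Real.exp_mul]
    congr 2; ring

/-- The volatility factors are almost surely at least `1`, so they preserve the lower bound on the
return factor. -/
theorem exists_measureReal_lt_volProd_pos
    (hur : ∃ r : ℝ, 0 < r ∧ 0 < (gaussianReal 0 1).real {x | r < u x}) (hu : Measurable u)
    (hb : ∀ n ∈ S, 0 ≤ b n) :
    ∃ r : ℝ, 0 < r ∧ 0 < innovMeasure.real {ω | r < volProd u b t S ω} := by
  obtain ⟨r, hr, hr'⟩ := hur
  refine ⟨r, hr, hr'.trans_le ?_⟩
  have hE : ∀ᵐ ω ∂innovMeasure, ∀ n ∈ S, 0 ≤ ω (Sum.inl n) := by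
    rw [Finset.eventually_all]
    intro n _
    have h := (hasLaw_eval_innovMeasure (Sum.inl n))
    have h2 : ∀ᵐ x ∂(innovMeasure.map fun ω => ω (Sum.inl n)), 0 ≤ x := by
      rw [h.map_eq]; exact ae_nonneg_expMeasure
    exact ae_of_ae_map h.aemeasurable h2
  have h := (hasLaw_eval_innovMeasure (Sum.inr t))
  have h3 : (gaussianReal 0 1).real {x | r < u x} =
      innovMeasure.real {ω | r < u (ω (Sum.inr t))} := by
    have : gaussianReal 0 1 = innovMeasure.map fun ω => ω (Sum.inr t) := h.map_eq.symm
    rw [this, map_measureReal_apply_of_aemeasurable h.aemeasurable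
      (measurableSet_lt measurable_const hu)]
    rfl
  rw [h3]
  refine ENNReal.toReal_mono (measure_ne_top _ _) (measure_mono_ae ?_)
  filter_upwards [hE] with ω hω (h4 : r < u (ω (Sum.inr t)))
  have h5 : 1 ≤ ∏ n ∈ S, Real.exp (b n * ω (Sum.inl n)) :=
    Finset.one_le_prod fun n hn => Real.one_le_exp (mul_nonneg (hb n hn) (hω n hn))
  exact h4.trans_le (le_mul_of_one_le_right (hr.trans h4).le h5)

/-- Multiply in the factors with `b n = 1` one at a time, starting from the product `S₀` of the
lighter ones. The case `T = ∅` is excluded because index `-1` appears only with the first such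
factor. -/
theorem scalesWith_measureReal_lt_volProd (hu : Measurable u)
    (hus : ∀ s : ℝ, 0 < s → Integrable (fun x => |u x| ^ s) (gaussianReal 0 1))
    (hur : ∃ r : ℝ, 0 < r ∧ 0 < (gaussianReal 0 1).real {x | r < u x})
    (hb : ∀ n ∈ S, b n ∈ Set.Icc 0 1) (h1 : ∃ n ∈ S, b n = 1) :
    (∀ y, 0 < innovMeasure.real {ω | y < volProd u b t S ω}) ∧
      ScalesWith (fun y => innovMeasure.real {ω | y < volProd u b t S ω}) (-1) := by
  set S₀ := S.filter fun n => b n ≠ 1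
  have key : ∀ T : Finset ℤ, T ⊆ S.filter (fun n => b n = 1) → T = ∅ ∨
      ((∀ y, 0 < innovMeasure.real {ω | y < volProd u b t (T ∪ S₀) ω}) ∧
      ScalesWith (fun y => innovMeasure.real {ω | y < volProd u b t (T ∪ S₀) ω}) (-1)) := by
    intro T
    induction T using Finset.induction_on with
    | empty => exact fun _ => Or.inl rfl
    | insert n T hn ih =>
      intro hT
      right
      have hT' := (Finset.subset_insert n T).trans hT
      have hn1 := (Finset.mem_filter.1 (hT (Finset.mem_insert_self n T))).2
      have hnU : n ∉ T ∪ S₀ := by simp [hn, S₀, hn1]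
      have hUS : T ∪ S₀ ⊆ S :=
        Finset.union_subset (hT'.trans (Finset.filter_subset _ _)) (Finset.filter_subset _ _)
      have hstep := scalesWith_measureReal_mul_exp (measurable_volProd hu b t (T ∪ S₀))
        (hasLaw_eval_innovMeasure (Sum.inl n)) (indepFun_volProd_eval hu hnU)
        (exists_measureReal_lt_volProd_pos hur hu fun k hk => (hb k (hUS hk)).1) ?_
      · simp only [Finset.insert_union, volProd_insert hnU, hn1, one_mul]
        exact hstep
      rcases ih hT' with rfl | h
      · left
        -- Finitely many coefficients, all below `1`, leave room for a moment of order `s > 1`.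
        have hev : ∀ᶠ s : ℝ in 𝓝[>] 1, ∀ n ∈ S₀, s * b n < 1 := by
          rw [Finset.eventually_all]
          intro k hk
          have hk' := Finset.mem_filter.1 hk
          have hlt : 1 * b k < 1 := by
            rw [one_mul]; exact lt_of_le_of_ne (hb k hk'.1).2 hk'.2
          exact nhdsWithin_le_nhds
            (((continuous_id.mul continuous_const).tendsto (1 : ℝ)).eventually (gt_mem_nhds hlt))
        obtain ⟨s, hs, hs1⟩ := (hev.and self_mem_nhdsWithin).exists
        have hs1' : (1 : ℝ) < s := hs1
        exact ⟨s, hs1', integrable_volProd_rpow hu (hus s (by linarith)) (by simpa using hs)⟩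
      · exact Or.inr h
  have hS : S.filter (fun n => b n = 1) ∪ S₀ = S := Finset.filter_union_filter_not_eq _ S
  obtain ⟨n, hn, hn1⟩ := h1
  rcases key _ subset_rfl with h | h
  · exact absurd (Finset.mem_filter.2 ⟨hn, hn1⟩) (h ▸ Finset.notMem_empty n)
  · rwa [hS] at h

theorem scalesWith_measureReal_lt_volProd_and_of_disjoint (hu : Measurable u)
    (hus : ∀ s : ℝ, 0 < s → Integrable (fun x => |u x| ^ s) (gaussianReal 0 1))
    (hur : ∃ r : ℝ, 0 < r ∧ 0 < (gaussianReal 0 1).real {x | r < u x})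
    (hb : ∀ n, b n ∈ Set.Icc 0 1) (h1 : ∃ n ∈ S, b n = 1) (h1' : ∃ n ∈ S', b n = 1)
    (htt : t ≠ t') (hS : Disjoint S S') :
    (∀ y, 0 < innovMeasure.real {ω | y < volProd u b t S ω ∧ y < volProd u b t' S' ω}) ∧
      ScalesWith (fun y =>
        innovMeasure.real {ω | y < volProd u b t S ω ∧ y < volProd u b t' S' ω})
        (-1 / (1 / 2)) := by
  have hmul : ∀ y, innovMeasure.real {ω | y < volProd u b t S ω ∧ y < volProd u b t' S' ω} =
      innovMeasure.real {ω | y < volProd u b t S ω} *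
        innovMeasure.real {ω | y < volProd u b t' S' ω} := fun y => by
    simp only [measureReal_def, ← ENNReal.toReal_mul]
    congr 1
    exact (indepFun_volProd hu htt hS).measure_inter_preimage_eq_mul (Set.Ioi y) (Set.Ioi y)
      measurableSet_Ioi measurableSet_Ioi
  obtain ⟨p, q⟩ := scalesWith_measureReal_lt_volProd (t := t) hu hus hur (fun n _ => hb n) h1
  obtain ⟨p', q'⟩ := scalesWith_measureReal_lt_volProd (t := t') hu hus hur (fun n _ => hb n) h1'
  simp only [hmul]
  refine ⟨fun y => mul_pos (p y) (p' y), ?_⟩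
  convert q.mul q' using 1
  norm_num

theorem scalesWith_measureReal_lt_volProd_and_of_inter (hu : Measurable u)
    (hus : ∀ s : ℝ, 0 < s → Integrable (fun x => |u x| ^ s) (gaussianReal 0 1))
    (hur : ∃ r : ℝ, 0 < r ∧ 0 < (gaussianReal 0 1).real {x | r < u x})
    (hb : ∀ n, b n ∈ Set.Icc 0 1) (htt : t ≠ t') {w : ℤ} (hS : S ∩ S' = {w})
    (hw : 1 / 2 < b w) :
    (∀ y, 0 < innovMeasure.real {ω | y < volProd u b t S ω ∧ y < volProd u b t' S' ω}) ∧
      ScalesWith (fun y =>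
        innovMeasure.real {ω | y < volProd u b t S ω ∧ y < volProd u b t' S' ω})
        (-1 / b w) := by
  have hwS : w ∈ S ∩ S' := by rw [hS]; exact Finset.mem_singleton_self w
  rw [Finset.mem_inter] at hwS
  have hc : 0 < b w := by linarith
  have hc2 : 1 / b w < 2 := by rw [div_lt_iff₀ hc]; linarith
  -- `s < 1` gives finite moments although coefficients may equal `1`; `2 * s > 1 / b w` makes the
  -- shared factor dominate. Both are possible because `b w > 1 / 2`.
  obtain ⟨s, hs1, hs2⟩ := exists_between (show 1 / b w / 2 < 1 by linarith)
  have hs : 0 < s := lt_trans (by positivity) hs1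
  have hsb : ∀ n, s * b n < 1 := fun n => by nlinarith [(hb n).1, (hb n).2]
  have hd : Disjoint (S.erase w) (S'.erase w) := by
    rw [Finset.disjoint_left]
    intro n h1 h2
    have : n ∈ S ∩ S' := Finset.mem_inter.2 ⟨Finset.mem_of_mem_erase h1, Finset.mem_of_mem_erase h2⟩
    rw [hS, Finset.mem_singleton] at this
    exact Finset.ne_of_mem_erase h1 this
  have h := scalesWith_measureReal_mul_exp_and (measurable_volProd hu b t (S.erase w))
    (measurable_volProd hu b t' (S'.erase w)) (hasLaw_eval_innovMeasure (Sum.inl w))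
    (indepFun_volProd_prodMk_eval hu (Finset.notMem_erase w S) (Finset.notMem_erase w S'))
    (indepFun_volProd hu htt hd) hc hs (by linarith)
    (exists_measureReal_lt_volProd_pos hur hu fun n _ => (hb n).1)
    (exists_measureReal_lt_volProd_pos hur hu fun n _ => (hb n).1)
    (integrable_volProd_rpow hu (hus s hs) fun n _ => hsb n)
    (integrable_volProd_rpow hu (hus s hs) fun n _ => hsb n)
  simp only [← volProd_insert (Finset.notMem_erase w _), Finset.insert_erase hwS.1,
    Finset.insert_erase hwS.2] at h
  exact h

end VolProd

theorem hasTailDependenceCoeff_of_scalesWith {Ω : Type*} [MeasurableSpace Ω] {P : Measure Ω}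
    [IsProbabilityMeasure P] {Y₀ Y₁ : Ω → ℝ} {c : ℝ} (hc : 0 < c) (hY : Measurable Y₀)
    (hid : IdentDistrib Y₀ Y₁ P P) (hpos : ∀ y, 0 < P.real {ω | y < Y₀ ω})
    (hG : ScalesWith (fun y => P.real {ω | y < Y₀ ω}) (-1))
    (hJpos : ∀ y, 0 < P.real {ω | y < Y₀ ω ∧ y < Y₁ ω})
    (hJ : ScalesWith (fun y => P.real {ω | y < Y₀ ω ∧ y < Y₁ ω}) (-1 / c)) :
    HasTailDependenceCoeff P Y₀ Y₁ c := by
  have : IsProbabilityMeasure (P.map Y₀) := Measure.isProbabilityMeasure_map hY.aemeasurable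
  have hmap : ∀ y, (P.map Y₀).real (Set.Ioi y) = P.real {ω | y < Y₀ ω} := fun y =>
    map_measureReal_apply hY measurableSet_Ioi
  refine ⟨hc, hid, isRegularlyVarying_comp_quantileFn (J := fun y => P.real {ω | y < Y₀ ω ∧ y < Y₁ ω})
    (by simpa only [hmap] using hpos) (by simpa only [hmap] using hG)
    (antitone_measureReal_lt Y₀ Y₁) hJpos hJ⟩

/-! ### Moving-average coefficients with prescribed overlaps -/

/-- The moving-average coefficients: for `q ≤ m` the positions `(2m+1) q` and `(2m+1) q + q`
carry the coefficient `c q`, all other coefficients vanish. -/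
def pairCoeff (m : ℕ) (c : ℕ → ℝ) (i : ℕ) : ℝ :=
  if i / (2 * m + 1) ≤ m ∧
      (i % (2 * m + 1) = 0 ∨ i % (2 * m + 1) = i / (2 * m + 1)) then
    c (i / (2 * m + 1)) else 0

section PairCoeff

variable {m : ℕ} {c : ℕ → ℝ}

theorem pairCoeff_left {q : ℕ} (hq : q ≤ m) : pairCoeff m c ((2 * m + 1) * q) = c q := by
  have h1 : (2 * m + 1) * q / (2 * m + 1) = q := Nat.mul_div_cancel_left q (by omega)
  simp [pairCoeff, h1, hq]

theorem pairCoeff_right {q : ℕ} (hq : q ≤ m) : pairCoeff m c ((2 * m + 1) * q + q) = c q := by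
  have h1 : ((2 * m + 1) * q + q) / (2 * m + 1) = q := by
    rw [Nat.mul_add_div (by omega), Nat.div_eq_of_lt (by omega), add_zero]
  have h2 : ((2 * m + 1) * q + q) % (2 * m + 1) = q := by
    rw [Nat.mul_add_mod, Nat.mod_eq_of_lt (by omega)]
  simp only [pairCoeff, h1, h2, hq, or_true, and_self, if_true]

theorem pairCoeff_mem_Icc (hc : ∀ q, q ≤ m → c q ∈ Set.Icc (0 : ℝ) 1) (i : ℕ) :
    pairCoeff m c i ∈ Set.Icc (0 : ℝ) 1 := by
  unfold pairCoeff
  split_ifs with h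
  · exact hc _ h.1
  · simp

theorem pairCoeff_eq_zero {i : ℕ} (hi : (2 * m + 1) * (m + 1) ≤ i) : pairCoeff m c i = 0 := by
  refine if_neg fun h => ?_
  have : m + 1 ≤ i / (2 * m + 1) := (Nat.le_div_iff_mul_le (by omega)).2 (by rwa [mul_comm])
  omega

/-- Nonzero positions have remainder at most `m` in blocks of length `2 * m + 1`, so a step `k ≤ m`
stays in the same block. Within block `q` the only two candidates are at distance `q`, which forces
`q = k`. -/
theorem eq_of_pairCoeff_ne_zero {i k : ℕ} (hk : 1 ≤ k) (hkm : k ≤ m)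
    (h1 : pairCoeff m c i ≠ 0) (h2 : pairCoeff m c (i + k) ≠ 0) : i = (2 * m + 1) * k := by
  have h1' := (ite_ne_right_iff.1 h1).1
  have h2' := (ite_ne_right_iff.1 h2).1
  have hi := Nat.div_add_mod i (2 * m + 1)
  set q := i / (2 * m + 1)
  set r := i % (2 * m + 1)
  have hlt : r + k < 2 * m + 1 := by omega
  have hq : (i + k) / (2 * m + 1) = q := by
    rw [← hi, add_assoc, Nat.mul_add_div (by omega), Nat.div_eq_of_lt hlt, add_zero]
  have hr : (i + k) % (2 * m + 1) = r + k := by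
    rw [← hi, add_assoc, Nat.mul_add_mod, Nat.mod_eq_of_lt hlt]
  rw [hq, hr] at h2'
  have hr0 : r = 0 := by omega
  have hqk : q = k := by omega
  rw [← hi, hr0, hqk, add_zero]

end PairCoeff

/-! ### The process and its tail dependence -/

/-- The process `exp (∑ i < L, α i ξ_{t-i}) u (ε_t)`. -/
def svProcess (u : ℝ → ℝ) (α : ℕ → ℝ) (L : ℕ) (t : ℤ) (ω : ℤ ⊕ ℤ → ℝ) : ℝ :=
  u (ω (Sum.inr t)) * ∏ i ∈ Finset.range L, Real.exp (α i * ω (Sum.inl (t - i)))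

/-- The time points whose log-volatility innovation enters at time `t`. -/
def loadTimes (α : ℕ → ℝ) (L : ℕ) (t : ℤ) : Finset ℤ :=
  ((Finset.range L).filter fun i => α i ≠ 0).image fun i : ℕ => t - i

theorem svProcess_eq_volProd (u : ℝ → ℝ) {α : ℕ → ℝ} {L : ℕ} {t : ℤ} {b : ℤ → ℝ}
    (hb : ∀ i, α i ≠ 0 → b (t - i) = α i) :
    svProcess u α L t = volProd u b t (loadTimes α L t) := by
  ext ω
  rw [svProcess, volProd, loadTimes, Finset.prod_image (fun i _ j _ h => by simpa using h),
    Finset.prod_filter]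
  congr 1
  refine Finset.prod_congr rfl fun i _ => ?_
  split_ifs with h
  · rw [hb i h]
  · rw [not_not.1 h]; simp

theorem measurable_svProcess {u : ℝ → ℝ} (hu : Measurable u) (α : ℕ → ℝ) (L : ℕ) (t : ℤ) :
    Measurable (svProcess u α L t) := by
  unfold svProcess
  refine (hu.comp (measurable_pi_apply _)).mul (Finset.measurable_prod _ fun n _ => ?_)
  fun_prop

/-- The product measure is invariant under the time shift by `t`. -/
theorem identDistrib_svProcess {u : ℝ → ℝ} (hu : Measurable u) (α : ℕ → ℝ) (L : ℕ) (t : ℤ) :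
    IdentDistrib (svProcess u α L 0) (svProcess u α L t) innovMeasure innovMeasure := by
  have hm := measurable_svProcess hu α L
  refine ⟨(hm 0).aemeasurable, (hm t).aemeasurable, ?_⟩
  let f : ℤ ⊕ ℤ → ℤ ⊕ ℤ := Sum.map (t + ·) (t + ·)
  have hf : Function.Injective f :=
    Sum.map_injective.2 ⟨add_right_injective t, add_right_injective t⟩
  have h := Measure.map_infinitePi_infinitePi_of_inj (P := innovLaw) hf
  have hP : (fun i => innovLaw (f i)) = innovLaw := by
    ext1 i; cases i <;> rfl
  have hmap : innovMeasure.map (fun ω i => ω (f i)) = innovMeasure := by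
    unfold innovMeasure
    rw [h]
    congr
  have hcomp : svProcess u α L t = svProcess u α L 0 ∘ fun ω i => ω (f i) := by
    ext ω
    simp only [svProcess, f, Function.comp_apply, Sum.map_inr, Sum.map_inl, add_zero, zero_sub]
    rfl
  rw [hcomp, ← Measure.map_map (hm 0) (by fun_prop), hmap]

/-- The return factor `u` treats both processes at once: `u = 1` yields the volatility, `u = id` the
returns. -/
theorem hasTailDependenceCoeff_svProcess {u : ℝ → ℝ} (hu : Measurable u)
    (hus : ∀ s : ℝ, 0 < s → Integrable (fun x => |u x| ^ s) (gaussianReal 0 1))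
    (hur : ∃ r : ℝ, 0 < r ∧ 0 < (gaussianReal 0 1).real {x | r < u x})
    {m : ℕ} {c : ℕ → ℝ} (hc0 : c 0 = 1) (hc : ∀ q, q ≤ m → c q ∈ Set.Icc (0 : ℝ) 1)
    {k : ℕ} (hk : 1 ≤ k) (hkm : k ≤ m) {e : ℝ}
    (he : c k = 0 ∧ e = 1 / 2 ∨ 1 / 2 < c k ∧ e = c k) :
    HasTailDependenceCoeff innovMeasure
      (svProcess u (pairCoeff m c) ((2 * m + 1) * (m + 1)) 0)
      (svProcess u (pairCoeff m c) ((2 * m + 1) * (m + 1)) k) e := by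
  set α := pairCoeff m c with hα
  set L := (2 * m + 1) * (m + 1) with hL
  have hL0 : 0 < L := by positivity
  have hα0 : α 0 = 1 := by
    have := pairCoeff_left (c := c) (Nat.zero_le m)
    rwa [mul_zero, hc0] at this
  -- One weight per time point must serve the products at times `0` and `k`. This is consistent
  -- because a shared innovation carries `c k` at both lags; values at time points used by neither
  -- product are irrelevant.
  let b : ℤ → ℝ := fun n =>
    if n ≤ 0 ∧ α (-n).toNat ≠ 0 then α (-n).toNat else α ((k : ℤ) - n).toNat
  have hbI : ∀ n, b n ∈ Set.Icc (0 : ℝ) 1 := fun n => by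
    simp only [b]
    split_ifs <;> exact pairCoeff_mem_Icc hc _
  have hb0 : ∀ i : ℕ, α i ≠ 0 → b (0 - i) = α i := fun i hi => by
    simp only [b]
    rw [if_pos] <;> simp [hi]
  have hbk : ∀ i : ℕ, α i ≠ 0 → b (k - i) = α i := fun i hi => by
    simp only [b]
    split_ifs with h
    · obtain ⟨h1, h2⟩ := h
      obtain ⟨j, rfl⟩ := Nat.exists_eq_add_of_le' (show k ≤ i by omega)
      have hj : (-((k : ℤ) - ((j + k : ℕ) : ℤ))).toNat = j := by omega
      rw [hj] at h2 ⊢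
      have := eq_of_pairCoeff_ne_zero hk hkm h2 hi
      rw [this, hα, pairCoeff_left hkm, pairCoeff_right hkm]
    · congr 1; omega
  have hmem : ∀ t : ℤ, t ∈ loadTimes α L t := fun t => by
    simp only [loadTimes, Finset.mem_image, Finset.mem_filter, Finset.mem_range]
    exact ⟨0, ⟨hL0, by rw [hα0]; exact one_ne_zero⟩, by simp⟩
  have hone : ∀ t : ℤ, (∀ i : ℕ, α i ≠ 0 → b (t - i) = α i) → ∃ n ∈ loadTimes α L t, b n = 1 :=
    fun t ht => ⟨t, hmem t, by simpa [hα0] using ht 0 (by rw [hα0]; exact one_ne_zero)⟩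
  have hinter : ∀ n : ℤ, n ∈ loadTimes α L 0 ∩ loadTimes α L k →
      c k ≠ 0 ∧ n = -(((2 * m + 1) * k : ℕ) : ℤ) := fun n hn => by
    simp only [loadTimes, Finset.mem_inter, Finset.mem_image, Finset.mem_filter,
      Finset.mem_range] at hn
    obtain ⟨⟨i, ⟨_, hi⟩, hin⟩, j, ⟨_, hj⟩, hjn⟩ := hn
    obtain rfl : j = i + k := by omega
    have := eq_of_pairCoeff_ne_zero hk hkm hi hj
    subst this
    rw [hα, pairCoeff_left hkm] at hi
    exact ⟨hi, by rw [← hin]; simp⟩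
  have ht : (0 : ℤ) ≠ k := by omega
  have hsc := scalesWith_measureReal_lt_volProd (t := 0) hu hus hur (fun n _ => hbI n) (hone 0 hb0)
  have hid := identDistrib_svProcess hu α L k
  have hms := measurable_svProcess hu α L 0
  have e0 := svProcess_eq_volProd u (L := L) hb0
  have ek := svProcess_eq_volProd u (L := L) hbk
  suffices hJ : _ ∧ ScalesWith (fun y => innovMeasure.real
      {ω | y < volProd u b 0 (loadTimes α L 0) ω ∧ y < volProd u b k (loadTimes α L k) ω})
      (-1 / e) by
    rw [e0, ek] at hid
    rw [e0] at hms
    rw [e0, ek]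
    refine hasTailDependenceCoeff_of_scalesWith ?_ hms hid hsc.1 hsc.2 hJ.1 hJ.2
    rcases he with ⟨_, rfl⟩ | ⟨h, rfl⟩
    · norm_num
    · linarith
  rcases he with ⟨h, rfl⟩ | ⟨h, rfl⟩
  · refine scalesWith_measureReal_lt_volProd_and_of_disjoint hu hus hur hbI (hone 0 hb0)
      (hone k hbk) ht ?_
    rw [Finset.disjoint_iff_inter_eq_empty, Finset.eq_empty_iff_forall_notMem]
    exact fun n hn => (hinter n hn).1 h
  · have hck : c k ≠ 0 := by linarith
    have hαl : α ((2 * m + 1) * k) = c k := pairCoeff_left hkm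
    have hαr : α ((2 * m + 1) * k + k) = c k := pairCoeff_right hkm
    have hlt : (2 * m + 1) * k + k < L := by
      by_contra! hle
      exact hck (hαr ▸ pairCoeff_eq_zero hle)
    have hbw : b (-(((2 * m + 1) * k : ℕ) : ℤ)) = c k := by
      have := hb0 ((2 * m + 1) * k) (by rwa [hαl])
      rwa [zero_sub, hαl] at this
    rw [← hbw]
    refine scalesWith_measureReal_lt_volProd_and_of_inter hu hus hur hbI ht ?_ (by rwa [hbw])
    ext n
    rw [Finset.mem_singleton]
    refine ⟨fun hn => (hinter n hn).2, ?_⟩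
    rintro rfl
    simp only [loadTimes, Finset.mem_inter, Finset.mem_image, Finset.mem_filter, Finset.mem_range]
    exact ⟨⟨(2 * m + 1) * k, ⟨by omega, by rwa [hαl]⟩, by simp⟩,
      ⟨(2 * m + 1) * k + k, ⟨hlt, by rwa [hαr]⟩, by push_cast; ring⟩⟩

/-! ### Verification of the model assumptions -/

theorem measureReal_Ioi_gaussianReal_pos (r : ℝ) : 0 < (gaussianReal 0 1).real (Set.Ioi r) := by
  rw [measureReal_def, ENNReal.toReal_pos_iff]
  refine ⟨pos_iff_ne_zero.2 fun h => ?_, measure_lt_top _ _⟩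
  simpa using gaussianReal_absolutelyContinuous' 0 one_ne_zero h

theorem integrable_abs_rpow_gaussianReal {s : ℝ} (hs : 0 < s) :
    Integrable (fun x => |x| ^ s) (gaussianReal 0 1) := by
  have h := (memLp_id_gaussianReal' (μ := 0) (v := 1) (ENNReal.ofReal s)
    ENNReal.ofReal_ne_top).integrable_norm_rpow (by simpa using hs) ENNReal.ofReal_ne_top
  simpa [ENNReal.toReal_ofReal hs.le] using h

theorem integrable_comp_eval_innovMeasure {f : ℝ → ℝ} {j : ℤ ⊕ ℤ}
    (hf : Integrable f (innovLaw j)) : Integrable (fun ω => f (ω j)) innovMeasure := by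
  have h := hasLaw_eval_innovMeasure j
  rw [← h.map_eq] at hf
  exact hf.comp_aemeasurable h.aemeasurable

theorem measureReal_eval_innovMeasure (j : ℤ ⊕ ℤ) {s : Set ℝ} (hs : MeasurableSet s) :
    innovMeasure.real {ω | ω j ∈ s} = (innovLaw j).real s := by
  have h := hasLaw_eval_innovMeasure j
  rw [← h.map_eq, map_measureReal_apply_of_aemeasurable h.aemeasurable hs]
  rfl

theorem isGammaTypeSVModel_svProcess {α : ℕ → ℝ} {L : ℕ} (hα : ∀ i, α i ∈ Set.Icc (0 : ℝ) 1)
    (hmax : ∃ i, α i = 1) (hL : ∀ i, L ≤ i → α i = 0) :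
    IsGammaTypeSVModel innovMeasure (svProcess id α L) (svProcess (fun _ => 1) α L) := by
  have hσ : ∀ t ω, svProcess (fun _ => 1) α L t ω =
      Real.exp (∑ i ∈ Finset.range L, α i * ω (Sum.inl (t - i))) := fun t ω => by
    rw [svProcess, one_mul, Real.exp_sum]
  refine ⟨α, fun t ω => ω (Sum.inl t), fun t ω => ω (Sum.inr t), ?_⟩
  constructor
  case measurable_X => exact measurable_svProcess measurable_id α L
  case measurable_σ => exact measurable_svProcess measurable_const α L
  case measurable_ξ => exact fun t => measurable_pi_apply _
  case measurable_ε => exact fun t => measurable_pi_apply _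
  case X_eq => exact fun t => ae_of_all _ fun ω => by simp [svProcess, mul_comm]
  case σ_pos => exact fun t => ae_of_all _ fun ω => by rw [hσ]; exact Real.exp_pos _
  case log_σ =>
    refine fun t => ae_of_all _ fun ω => ?_
    rw [hσ, Real.log_exp]
    refine hasSum_sum_of_ne_finset_zero fun i hi => ?_
    rw [hL i (by simpa using hi), zero_mul]
  case iIndepFun_ε => exact iIndepFun_eval_innovMeasure.precomp Sum.inr_injective
  case identDistrib_ε =>
    exact fun t => (hasLaw_eval_innovMeasure (Sum.inr t)).identDistrib
      (hasLaw_eval_innovMeasure (Sum.inr 0))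
  case ε_pos =>
    have h := measureReal_eval_innovMeasure (Sum.inr 0) (measurableSet_Ioi (a := (0 : ℝ)))
    have h2 : 0 < innovMeasure.real {ω | 0 < ω (Sum.inr 0)} :=
      (measureReal_Ioi_gaussianReal_pos 0).trans_eq h.symm
    exact (ENNReal.toReal_pos_iff.1 h2).1
  case ε_moment =>
    exact ⟨1, one_pos, integrable_comp_eval_innovMeasure (j := Sum.inr 0)
      (f := fun x => |x| ^ ((1 : ℝ) + 1)) (integrable_abs_rpow_gaussianReal (by norm_num))⟩
  case α_mem => exact hα
  case α_max =>
    refine ⟨hmax, ?_⟩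
    rintro _ ⟨i, rfl⟩
    exact (hα i).2
  case α_decay =>
    refine ⟨2, one_lt_two, IsBigO.of_bound 0 ?_⟩
    filter_upwards [eventually_ge_atTop L] with i hi
    simp [hL i hi]
  case iIndepFun_ξ => exact iIndepFun_eval_innovMeasure.precomp Sum.inl_injective
  case identDistrib_ξ =>
    exact fun t => (hasLaw_eval_innovMeasure (Sum.inl t)).identDistrib
      (hasLaw_eval_innovMeasure (Sum.inl 0))
  case indep_ξ_ε =>
    refine IndepFun.process_indepFun_process (fun t => measurable_pi_apply _)
      (fun t => measurable_pi_apply _) fun I J => ?_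
    refine indepFun_of_dependsOn (by fun_prop) (by fun_prop) (S := I.disjSum ∅)
      (T := (∅ : Finset ℤ).disjSum J) ?_ ?_ ?_
    · rw [Finset.disjoint_left]
      rintro (n | n) <;> simp
    · intro ω ω' h
      ext i
      exact h (Sum.inl i) (by simp)
    · intro ω ω' h
      ext i
      exact h (Sum.inr i) (by simp)
  case ξ_moment =>
    exact integrable_comp_eval_innovMeasure (j := Sum.inl 0) (f := fun x => x ^ 2)
      integrable_sq_expMeasure
  case ξ_tail =>
    -- The exponential tail is exactly `exp (-z)` for `z ≥ 0`.
    refine ⟨0, 1, by norm_num, one_pos, EventuallyEq.isEquivalent ?_⟩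
    filter_upwards [eventually_ge_atTop 0] with z hz
    have h := measureReal_eval_innovMeasure (Sum.inl 0) (measurableSet_Ioi (a := z))
    rw [Real.rpow_zero, one_mul, one_mul, ← measureReal_Ioi_expMeasure hz]
    exact h


end

/-! ### Choice of coefficients and conclusion -/

theorem mainTheorem3 (m : ℕ) (hm : 1 ≤ m) (η : ℕ → ℝ)
    (hη : ∀ h ∈ Finset.Icc 1 m, η h ∈ Set.Icc (1 / 2 : ℝ) 1) :
    ∃ (Ω : Type) (_ : MeasurableSpace Ω) (P : Measure Ω) (_ : IsProbabilityMeasure P)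
      (X σ : ℤ → Ω → ℝ),
      IsGammaTypeSVModel P X σ ∧
        ∀ h ∈ Finset.Icc 1 m,
          HasTailDependenceCoeff P (σ 0) (σ (h : ℤ)) (η h) ∧
            HasTailDependenceCoeff P (X 0) (X (h : ℤ)) (η h) := by
  -- `c 0 = 1` supplies the maximal coefficient and hence the marginal index `-1`. The value `η q =
  -- 1 / 2` is obtained by sharing nothing, since a shared coefficient `1 / 2` would be the
  -- borderline case of the moment condition.
  let c : ℕ → ℝ := fun q => if q = 0 then 1 else if 1 / 2 < η q then η q else 0
  have hc0 : c 0 = 1 := by simp [c]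
  have hc : ∀ q, q ≤ m → c q ∈ Set.Icc (0 : ℝ) 1 := by
    intro q hq
    simp only [c]
    split_ifs with h1 h2
    · simp
    · exact ⟨by linarith, (hη q (Finset.mem_Icc.2 ⟨by omega, hq⟩)).2⟩
    · simp
  refine ⟨ℤ ⊕ ℤ → ℝ, inferInstance, innovMeasure, inferInstance,
    svProcess id (pairCoeff m c) ((2 * m + 1) * (m + 1)),
    svProcess (fun _ => 1) (pairCoeff m c) ((2 * m + 1) * (m + 1)),
    isGammaTypeSVModel_svProcess (pairCoeff_mem_Icc hc) ⟨0, ?_⟩ fun i hi => pairCoeff_eq_zero hi,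
    fun k hk => ?_⟩
  · have := pairCoeff_left (c := c) (Nat.zero_le m)
    rwa [mul_zero, hc0] at this
  have hk' := Finset.mem_Icc.1 hk
  have he : c k = 0 ∧ η k = 1 / 2 ∨ 1 / 2 < c k ∧ η k = c k := by
    have hk0 : k ≠ 0 := by omega
    by_cases h : 1 / 2 < η k
    · exact Or.inr (by simp only [c, hk0, h, if_true, if_false, and_self])
    · exact Or.inl ⟨by simp only [c, hk0, h, if_false], le_antisymm (not_lt.1 h) (hη k hk).1⟩
  constructor
  · exact hasTailDependenceCoeff_svProcess measurable_const (fun s _ => by simp)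
      ⟨1 / 2, by norm_num, by norm_num⟩ hc0 hc hk'.1 hk'.2 he
  · exact hasTailDependenceCoeff_svProcess measurable_id
      (fun s hs => integrable_abs_rpow_gaussianReal hs)
      ⟨1, one_pos, measureReal_Ioi_gaussianReal_pos 1⟩ hc0 hc hk'.1 hk'.2 he
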